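/- There is a universal constant $c>0$ with the following property. Let $d\in\mathbb N$, let $\mathcal A\subset\mathbb R^d$ be a finite action class with at least two elements, and let $\mu\in\mathbb R^d$ be such that $\pi\mapsto\mu^\top\pi$ has a unique maximizer $\pi^*$ on $\mathcal A$. For each arm $s\in\{1,\dots,d\}$ let $$\Delta_s=\min_{\pi\in\mathcal A\setminus\{\pi^*\}}\frac{\mu^\top(\pi^*-\pi)}{|\pi^*_s-\pi_s|}\in(0,\infty]$$ be the G-gap (a quotient with denominator $0$ is read as $+\infty$), and let $\mathbf H=\sum_{s=1}^d 1/\Delta_s^2$ (with $1/\infty=0$). Then there are real numbers $x_1,\dots,x_d$ with $|x_s|\le 2\Delta_s$, depending only on $(\mathcal A,\mu)$, such that for every $R>0$, every budget $T\in\{0,1,2,\dots\}$ and every (possibly adaptive and randomized) algorithm that makes $T$ arm pulls and then returns an output $\pi^{\mathrm{out}}\in\mathbb R^d$, at least one mean vector $\mu'$ among the $d+1$ vectors $\mu,\ \mu+x_1e_1,\ \dots,\ \mu+x_de_d$ (where $e_s$ is the $s$-th standard basis vector) satisfies $$\Pr_{\mu'}\Bigl[\pi^{\mathrm{out}}\notin\operatorname*{arg\,max}_{\pi\in\mathcal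 A}\mu'^\top\pi\Bigr]\ \ge\ c\,\exp\Bigl(-\frac{T}{R^2\,\mathbf H}\Bigr).$$ Here $\Pr_{\mu'}$ is the law of the interaction with the bandit in which the rewards of arm $s$ are independent samples of $\mathcal N(\mu'_s,R^2)$. In particular, for unit-variance Gaussian arms ($R=1$) the worst-case probability of error is at least $c\,\exp(-T/\mathbf H)$. -/

import Mathlib

open MeasureTheory ProbabilityTheory
open scoped ENNReal NNReal

noncomputable section

namespace RCPE

/-- A `d`-armed stochastic bandit is a Markov kernel sending each arm to its reward distribution.
This is the one whose arm `s` has the normal law with mean `μ s` and standard deviation `R`. -/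
def gaussianBandit {d : ℕ} (μ : Fin d → ℝ) (R : ℝ≥0) : Kernel (Fin d) ℝ :=
  Kernel.ofFunOfCountable fun s => gaussianReal (μ s) (R ^ 2)

instance {d : ℕ} (μ : Fin d → ℝ) (R : ℝ≥0) : IsMarkovKernel (gaussianBandit μ R) :=
  ⟨fun s => inferInstanceAs (IsProbabilityMeasure (gaussianReal (μ s) (R ^ 2)))⟩

/-- The vector of expected rewards of a bandit. -/
def meanReward {d : ℕ} (ν : Kernel (Fin d) ℝ) (s : Fin d) : ℝ := ∫ x, x ∂(ν s)

/-- What has been observed in the first `t` rounds: the arms pulled and the rewards received. -/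
abbrev History (d t : ℕ) : Type := Fin t → Fin d × ℝ

/-- A fixed-budget algorithm with budget `T`. In round `t` (rounds count from `0`) it draws the arm
to pull from a law that depends measurably on the history; after `T` pulls it draws its output.
Deterministic algorithms are those whose kernels are Dirac. Only `policy t` with `t < T` is used. -/
structure Algorithm (d T : ℕ) where
  policy : (t : ℕ) → Kernel (History d t) (Fin d)
  policy_markov : ∀ t, IsMarkovKernel (policy t)
  output : Kernel (History d T) (Fin d → ℝ)
  output_markov : IsMarkovKernel output

/-- The law of the next (arm, reward) pair given the history: the arm comes from the policy, and,
given the arm, the reward is a fresh sample of the reward distribution of that arm. -/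
def stepKernel {d T : ℕ} (ν : Kernel (Fin d) ℝ) (alg : Algorithm d T) (t : ℕ) :
    Kernel (History d t) (Fin d × ℝ) :=
  alg.policy t ⊗ₖ Kernel.prodMkLeft (History d t) ν

/-- The law of the history after `t` rounds of interaction of the algorithm with the bandit. -/
def historyLaw {d T : ℕ} (ν : Kernel (Fin d) ℝ) (alg : Algorithm d T) :
    (t : ℕ) → Measure (History d t)
  | 0 => Measure.dirac Fin.elim0
  | t + 1 => (historyLaw ν alg t ⊗ₘ stepKernel ν alg t).map
      fun p => (Fin.snoc p.1 p.2 : History d (t + 1))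

/-- The law of the output of the algorithm after `T` pulls. -/
def outputLaw {d T : ℕ} (ν : Kernel (Fin d) ℝ) (alg : Algorithm d T) : Measure (Fin d → ℝ) :=
  (historyLaw ν alg T).bind alg.output

/-- `p` is a best action of the class `A` for the mean vector `μ`. -/
def IsBest {d : ℕ} (A : Finset (Fin d → ℝ)) (μ p : Fin d → ℝ) : Prop :=
  p ∈ A ∧ ∀ q ∈ A, μ ⬝ᵥ q ≤ μ ⬝ᵥ p

/-- `p` is the only best action of the class `A` for the mean vector `μ`. -/
def IsUniqueBest {d : ℕ} (A : Finset (Fin d → ℝ)) (μ p : Fin d → ℝ) : Prop :=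
  p ∈ A ∧ ∀ q ∈ A, q ≠ p → μ ⬝ᵥ q < μ ⬝ᵥ p

/-- The probability that the output of the algorithm is not a best action of the bandit. -/
def errorProb {d T : ℕ} (A : Finset (Fin d → ℝ)) (ν : Kernel (Fin d) ℝ) (alg : Algorithm d T) :
    ℝ :=
  (outputLaw ν alg).real {p | ¬ IsBest A (meanReward ν) p}

/-- The G-gap `Δ_s = min_{q ∈ A, q ≠ p} μᵀ(p - q) / |p_s - q_s|`, for `p` the best action. Actions
`q` with `q_s = p_s` contribute `∞`; so `Δ_s = ∞` when all actions have the same `s`-th entry. -/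
def gGap {d : ℕ} (A : Finset (Fin d → ℝ)) (μ p : Fin d → ℝ) (s : Fin d) : ℝ≥0∞ :=
  ⨅ q ∈ A.erase p, ENNReal.ofReal (μ ⬝ᵥ (p - q)) / ENNReal.ofReal |p s - q s|

/-- The complexity `H = ∑_s (1 / Δ_s)²`, where `1 / ∞ = 0`. -/
def complexity {d : ℕ} (A : Finset (Fin d → ℝ)) (μ p : Fin d → ℝ) : ℝ :=
  ∑ s, ((gGap A μ p s)⁻¹.toReal) ^ 2

end RCPE

end

/-! Fix the algorithm and run it on `μ`. Its expected pull counts sum to `T`, so by averaging some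
arm `s` of finite gap has `E[N_s] ≤ T / (Δ_s² H)` (`exists_expectedPulls_mul_complexity_le`). Moving
the mean of that arm slightly beyond its gap, towards an action attaining the gap, makes `p`
suboptimal (`exists_perturbation`). The two interactions have divergence `E[N_s] x_s² / (2R²) ≤ T /
(R² H)`, so by Bretagnolle–Huber (`exp_le_outputLaw_gaussianBandit_update`) the probability of not
returning `p` under `μ` plus that of returning `p` under the perturbed mean is at least half the
exponential. Both events are errors, so one has probability at least a quarter of it. -/

namespace RCPE

/-! ### Change of measure for adaptive sampling. -/

section ChangeOfMeasure

/-- The Bretagnolle–Huber inequality, for a density given through its logarithm. -/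
theorem exp_integral_le_measureReal_add_compl {Ω : Type*} [MeasurableSpace Ω] {P Q : Measure Ω}
    [IsProbabilityMeasure P] [IsProbabilityMeasure Q] {l : Ω → ℝ} (hl : Measurable l)
    (hint : Integrable l P) (hQ : Q = P.withDensity fun ω => ENNReal.ofReal (Real.exp (l ω)))
    {S : Set Ω} (hS : MeasurableSet S) :
    Real.exp (∫ ω, l ω ∂P) / 2 ≤ P.real S + Q.real Sᶜ := by
  have hexp : Measurable fun ω => Real.exp (l ω) := Real.measurable_exp.comp hl
  have hlin : ∫⁻ ω, ENNReal.ofReal (Real.exp (l ω)) ∂P = 1 := by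
    have h : Q Set.univ = 1 := measure_univ
    rwa [hQ, withDensity_apply _ MeasurableSet.univ, Measure.restrict_univ] at h
  have hL : Integrable (fun ω => Real.exp (l ω)) P := by
    refine ⟨hexp.aestronglyMeasurable, ?_⟩
    rw [hasFiniteIntegral_iff_ofReal (ae_of_all _ fun ω => (Real.exp_pos _).le), hlin]
    exact ENNReal.one_lt_top
  have hLone : ∫ ω, Real.exp (l ω) ∂P = 1 := by
    rw [integral_eq_lintegral_of_nonneg_ae (ae_of_all _ fun ω => (Real.exp_pos _).le)
      hexp.aestronglyMeasurable, hlin, ENNReal.toReal_one]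
  have hQS : Q.real Sᶜ = ∫ ω, Sᶜ.indicator (fun ω => Real.exp (l ω)) ω ∂P := by
    rw [integral_indicator hS.compl,
      integral_eq_lintegral_of_nonneg_ae (ae_of_all _ fun ω => (Real.exp_pos _).le)
      hexp.aestronglyMeasurable, Measure.real, hQ, withDensity_apply _ hS.compl]
  have hPS : P.real S = ∫ ω, S.indicator (fun _ => (1 : ℝ)) ω ∂P := by
    rw [integral_indicator_const _ hS]; simp
  set K := ∫ ω, l ω ∂P with hK
  set a := Real.exp (K / 2) with ha
  have hapos : 0 < a := Real.exp_pos _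
  have haa : Real.exp K = a ^ 2 := by rw [ha, ← Real.exp_nat_mul]; ring_nf
  have hi1 : Integrable (S.indicator fun _ => (1 : ℝ)) P := (integrable_const _).indicator hS
  have hi2 : Integrable (Sᶜ.indicator fun ω => Real.exp (l ω)) P := hL.indicator hS.compl
  -- With `y = exp (l / 2)`, the tangent to `exp` at `K / 2` bounds the left side by `a * y`, and
  -- AM-GM bounds `a * y` by the right side, separately on `S` and off it. The integrals of the two
  -- sides are `a ^ 2` and `P.real S + Q.real Sᶜ + a ^ 2 / 2`.
  have hpt : ∀ ω, a ^ 2 * (1 - K / 2) + a ^ 2 / 2 * l ω ≤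
      S.indicator (fun _ => (1 : ℝ)) ω + Sᶜ.indicator (fun ω => Real.exp (l ω)) ω
        + (a ^ 2 / 4 + a ^ 2 / 4 * Real.exp (l ω)) := by
    intro ω
    set y := Real.exp (l ω / 2) with hy
    have hyy : Real.exp (l ω) = y ^ 2 := by rw [hy, ← Real.exp_nat_mul]; ring_nf
    have htan : a * (1 + (l ω - K) / 2) ≤ y := by
      have h1 : y = a * Real.exp ((l ω - K) / 2) := by
        rw [hy, ha, ← Real.exp_add]; ring_nf
      rw [h1]
      have h2 := Real.add_one_le_exp ((l ω - K) / 2)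
      exact mul_le_mul_of_nonneg_left (by linarith) hapos.le
    have htan' := mul_le_mul_of_nonneg_left htan hapos.le
    by_cases hω : ω ∈ S
    · simp only [Set.indicator_of_mem hω, Set.indicator_of_notMem (Set.notMem_compl_iff.2 hω), hyy]
      nlinarith [sq_nonneg (a * y / 2 - 1), sq_nonneg a]
    · simp only [Set.indicator_of_notMem hω, Set.indicator_of_mem (Set.mem_compl hω), hyy]
      nlinarith [sq_nonneg (a / 2 - y), sq_nonneg (a * y)]
  have hi3 : Integrable (fun ω => S.indicator (fun _ => (1 : ℝ)) ω +
      Sᶜ.indicator (fun ω => Real.exp (l ω)) ω) P := hi1.add hi2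
  have hi4 : Integrable (fun ω => a ^ 2 / 4 + a ^ 2 / 4 * Real.exp (l ω)) P :=
    (integrable_const _).add (hL.const_mul _)
  have hmono := integral_mono
    ((integrable_const (a ^ 2 * (1 - K / 2))).add (hint.const_mul (a ^ 2 / 2)))
    (hi3.add hi4) hpt
  simp only [Pi.add_apply] at hmono
  rw [integral_add (integrable_const _) (hint.const_mul _), integral_add hi3 hi4,
    integral_add hi1 hi2, integral_add (integrable_const _) (hL.const_mul _), ← hPS,
    ← hQS] at hmono
  simp only [integral_const, integral_const_mul, hLone, ← hK, probReal_univ, smul_eq_mul,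
    one_mul] at hmono
  rw [haa]
  linarith

theorem gaussianReal_add_eq_withDensity (m x : ℝ) {v : ℝ≥0} (hv : v ≠ 0) :
    gaussianReal (m + x) v = (gaussianReal m v).withDensity
      fun r => ENNReal.ofReal (Real.exp (x / v * (r - m) - x ^ 2 / (2 * v))) := by
  have hv' : (v : ℝ) ≠ 0 := by exact_mod_cast hv
  rw [gaussianReal_of_var_ne_zero _ hv, gaussianReal_of_var_ne_zero _ hv,
    ← withDensity_mul _ (measurable_gaussianPDF m v) (by fun_prop)]
  congr 1
  ext r
  simp only [Pi.mul_apply, gaussianPDF]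
  rw [← ENNReal.ofReal_mul (gaussianPDFReal_nonneg _ _ _)]
  congr 1
  simp only [gaussianPDFReal]
  rw [mul_assoc _ (Real.exp _), ← Real.exp_add]
  congr 2
  field_simp
  ring

variable {d T : ℕ}

instance isMarkovKernel_stepKernel (ν : Kernel (Fin d) ℝ) [IsMarkovKernel ν] (alg : Algorithm d T)
    (t : ℕ) : IsMarkovKernel (stepKernel ν alg t) := by
  have := alg.policy_markov t
  unfold stepKernel
  infer_instance

theorem measurable_snoc (t : ℕ) : Measurable
    fun p : History d t × (Fin d × ℝ) => (Fin.snoc p.1 p.2 : History d (t + 1)) := by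
  refine measurable_pi_lambda _ fun i => ?_
  induction i using Fin.lastCases with
  | last => simpa using measurable_snd
  | cast i =>
    simp only [Fin.snoc_castSucc]
    exact (measurable_pi_apply i).comp measurable_fst

theorem measurable_arm {t : ℕ} (i : Fin t) : Measurable fun h : History d t => (h i).1 :=
  measurable_fst.comp (measurable_pi_apply i)

instance isProbabilityMeasure_historyLaw (ν : Kernel (Fin d) ℝ) [IsMarkovKernel ν]
    (alg : Algorithm d T) : ∀ t, IsProbabilityMeasure (historyLaw ν alg t)
  | 0 => by unfold historyLaw; infer_instance
  | t + 1 => by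
    have := isProbabilityMeasure_historyLaw ν alg t
    unfold historyLaw
    exact Measure.isProbabilityMeasure_map (measurable_snoc t).aemeasurable

theorem lintegral_historyLaw_succ (ν : Kernel (Fin d) ℝ) [IsMarkovKernel ν]
    (alg : Algorithm d T) (t : ℕ) {f : History d (t + 1) → ℝ≥0∞} (hf : Measurable f) :
    ∫⁻ h, f h ∂(historyLaw ν alg (t + 1)) =
      ∫⁻ h, ∫⁻ a, ∫⁻ r, f (Fin.snoc h (a, r)) ∂(ν a) ∂(alg.policy t h)
        ∂(historyLaw ν alg t) := by
  have := alg.policy_markov t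
  have hm : Measurable fun p : History d t × (Fin d × ℝ) => f (Fin.snoc p.1 p.2) :=
    hf.comp (measurable_snoc t)
  rw [historyLaw, lintegral_map hf (measurable_snoc t), Measure.lintegral_compProd hm]
  refine lintegral_congr fun h => ?_
  exact Kernel.lintegral_compProd _ _ _ (hm.comp measurable_prodMk_left)

/-- The policy is the same under both bandits and cancels from the likelihood ratio, leaving one
reward factor per round. -/
theorem historyLaw_eq_withDensity {ν ν' : Kernel (Fin d) ℝ} [IsMarkovKernel ν]
    [IsMarkovKernel ν'] (alg : Algorithm d T) {l : Fin d × ℝ → ℝ} (hl : Measurable l)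
    (hν : ∀ a, ν' a = (ν a).withDensity fun r => ENNReal.ofReal (Real.exp (l (a, r)))) (t : ℕ) :
    historyLaw ν' alg t = (historyLaw ν alg t).withDensity
      fun h => ENNReal.ofReal (Real.exp (∑ i, l (h i))) := by
  have hmeas : ∀ t, Measurable fun h : History d t =>
      ENNReal.ofReal (Real.exp (∑ i, l (h i))) := by
    intro t
    fun_prop
  induction t with
  | zero =>
    simp [historyLaw]
  | succ t ih =>
    refine Measure.ext_of_lintegral _ fun f hf => ?_
    rw [lintegral_withDensity_eq_lintegral_mul _ (hmeas _) hf, lintegral_historyLaw_succ _ _ _ hf,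
      lintegral_historyLaw_succ _ _ _ ((hmeas _).mul hf), ih]
    have := alg.policy_markov t
    have hin : ∀ a, Measurable fun p : History d t × ℝ => f (Fin.snoc p.1 (a, p.2)) := fun a =>
      hf.comp ((measurable_snoc t).comp (measurable_fst.prodMk
        (measurable_const.prodMk measurable_snd)))
    have hin2 : Measurable fun p : History d t × Fin d =>
        ∫⁻ r, f (Fin.snoc p.1 (p.2, r)) ∂(ν' p.2) := by
      refine measurable_from_prod_countable_left fun a => ?_
      exact (hin a).lintegral_prod_right' (ν := ν' a)
    rw [lintegral_withDensity_eq_lintegral_mul _ (hmeas _) (hin2.lintegral_kernel_prod_right')]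
    refine lintegral_congr fun h => ?_
    simp only [Pi.mul_apply]
    rw [← lintegral_const_mul _ (measurable_of_countable _)]
    refine lintegral_congr fun a => ?_
    have hfa : Measurable fun r => f (Fin.snoc h (a, r)) := (hin a).comp measurable_prodMk_left
    rw [hν a, lintegral_withDensity_eq_lintegral_mul _ (by fun_prop) hfa,
      ← lintegral_const_mul _ (Measurable.mul (by fun_prop) hfa)]
    refine lintegral_congr fun r => ?_
    simp only [Pi.mul_apply, Fin.sum_univ_castSucc, Fin.snoc_castSucc, Fin.snoc_last]
    rw [Real.exp_add, ENNReal.ofReal_mul (Real.exp_pos _).le, mul_assoc]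

/-- Given the arm of a round, the reward of that round is a sample of the law of that arm. -/
theorem map_historyLaw_eval (ν : Kernel (Fin d) ℝ) [IsMarkovKernel ν] (alg : Algorithm d T)
    (t : ℕ) (i : Fin t) :
    (historyLaw ν alg t).map (fun h => h i) =
      (historyLaw ν alg t).map (fun h => (h i).1) ⊗ₘ ν := by
  induction t with
  | zero => exact i.elim0
  | succ t ih =>
    refine Measure.ext_of_lintegral _ fun f hf => ?_
    have hg : Measurable fun a => ∫⁻ r, f (a, r) ∂(ν a) := measurable_of_countable _
    have := alg.policy_markov t
    rw [lintegral_map hf (measurable_pi_apply i), Measure.lintegral_compProd hf,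
      lintegral_map hg (measurable_arm i),
      lintegral_historyLaw_succ _ _ _ (f := fun h => f (h i)) (hf.comp (measurable_pi_apply i)),
      lintegral_historyLaw_succ _ _ _ (f := fun h => ∫⁻ r, f ((h i).1, r) ∂(ν (h i).1))
        (hg.comp (measurable_arm i))]
    induction i using Fin.lastCases with
    | last => simp
    | cast i =>
      have h := congrArg (fun m => ∫⁻ p, f p ∂m) (ih i)
      rw [lintegral_map hf (measurable_pi_apply i), Measure.lintegral_compProd hf,
        lintegral_map hg (measurable_arm i)] at h
      simpa using h

/-- The expected number of pulls of the arm `s`. -/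
noncomputable def expectedPulls (ν : Kernel (Fin d) ℝ) (alg : Algorithm d T) (s : Fin d) : ℝ :=
  ∑ i, ((historyLaw ν alg T).map fun h => (h i).1).real {s}

theorem expectedPulls_nonneg (ν : Kernel (Fin d) ℝ) (alg : Algorithm d T) (s : Fin d) :
    0 ≤ expectedPulls ν alg s :=
  Finset.sum_nonneg fun _ _ => measureReal_nonneg

theorem sum_expectedPulls (ν : Kernel (Fin d) ℝ) [IsMarkovKernel ν] (alg : Algorithm d T) :
    ∑ s, expectedPulls ν alg s = T := by
  unfold expectedPulls
  rw [Finset.sum_comm]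
  have h : ∀ i : Fin T, ∑ s, ((historyLaw ν alg T).map fun h => (h i).1).real {s} = 1 := by
    intro i
    have : IsProbabilityMeasure ((historyLaw ν alg T).map fun h => (h i).1) :=
      Measure.isProbabilityMeasure_map (measurable_arm i).aemeasurable
    rw [sum_measureReal_singleton, Finset.coe_univ, probReal_univ]
  simp [h]

/-- A Wald-type identity: rounds are dependent, but linearity needs only the law of each single
round, given by `map_historyLaw_eval`. -/
theorem integral_sum_historyLaw (ν : Kernel (Fin d) ℝ) [IsMarkovKernel ν] (alg : Algorithm d T)
    {l : Fin d × ℝ → ℝ} (hl : Measurable l) (hint : ∀ a, Integrable (fun r => l (a, r)) (ν a)) :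
    Integrable (fun h => ∑ i, l (h i)) (historyLaw ν alg T) ∧
      ∫ h, ∑ i, l (h i) ∂(historyLaw ν alg T) =
        ∑ a, expectedPulls ν alg a * ∫ r, l (a, r) ∂(ν a) := by
  have hcomp : ∀ i, Integrable l ((historyLaw ν alg T).map fun h => h i) := by
    intro i
    have : IsProbabilityMeasure ((historyLaw ν alg T).map fun h => (h i).1) :=
      Measure.isProbabilityMeasure_map (measurable_arm i).aemeasurable
    rw [map_historyLaw_eval, Measure.integrable_compProd_iff hl.aestronglyMeasurable]
    exact ⟨ae_of_all _ hint, Integrable.of_finite⟩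
  have hi : ∀ i : Fin T, Integrable (fun h => l (h i)) (historyLaw ν alg T) := fun i =>
    (hcomp i).comp_measurable (measurable_pi_apply i)
  refine ⟨integrable_finsetSum _ fun i _ => hi i, ?_⟩
  rw [integral_finsetSum _ fun i _ => hi i]
  simp only [expectedPulls, Finset.sum_mul]
  rw [Finset.sum_comm]
  refine Finset.sum_congr rfl fun i _ => ?_
  have : IsProbabilityMeasure ((historyLaw ν alg T).map fun h => (h i).1) :=
    Measure.isProbabilityMeasure_map (measurable_arm i).aemeasurable
  have h := hcomp i
  rw [← integral_map (φ := fun h : History d T => h i) (f := l)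
    (measurable_pi_apply i).aemeasurable hl.aestronglyMeasurable]
  rw [map_historyLaw_eval] at h ⊢
  rw [Measure.integral_compProd h, integral_fintype Integrable.of_finite]
  simp

theorem outputLaw_eq_snd (ν : Kernel (Fin d) ℝ) [IsMarkovKernel ν] (alg : Algorithm d T) :
    outputLaw ν alg = (historyLaw ν alg T ⊗ₘ alg.output).snd := by
  have := alg.output_markov
  rw [Measure.snd_compProd, outputLaw]

instance isProbabilityMeasure_outputLaw (ν : Kernel (Fin d) ℝ) [IsMarkovKernel ν]
    (alg : Algorithm d T) : IsProbabilityMeasure (outputLaw ν alg) := by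
  have := alg.output_markov
  rw [outputLaw_eq_snd]
  infer_instance

/-- A bound, by the expected log-likelihood ratio of the rewards, on how well the output of an
algorithm can separate two bandits. -/
theorem exp_sum_le_outputLaw_add_compl {ν ν' : Kernel (Fin d) ℝ} [IsMarkovKernel ν]
    [IsMarkovKernel ν'] (alg : Algorithm d T) {l : Fin d × ℝ → ℝ} (hl : Measurable l)
    (hint : ∀ a, Integrable (fun r => l (a, r)) (ν a))
    (hν : ∀ a, ν' a = (ν a).withDensity fun r => ENNReal.ofReal (Real.exp (l (a, r))))
    {S : Set (Fin d → ℝ)} (hS : MeasurableSet S) :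
    Real.exp (∑ a, expectedPulls ν alg a * ∫ r, l (a, r) ∂(ν a)) / 2 ≤
      (outputLaw ν alg).real S + (outputLaw ν' alg).real Sᶜ := by
  have := alg.output_markov
  obtain ⟨hI, hE⟩ := integral_sum_historyLaw ν alg hl hint
  have hsum : Measurable fun h : History d T => ∑ i, l (h i) := by fun_prop
  have hfst : (historyLaw ν alg T ⊗ₘ alg.output).map Prod.fst = historyLaw ν alg T :=
    Measure.fst_compProd _ _
  -- Randomizing the output adds no information: its kernel is common to both joint laws, so the
  -- density depends on the history alone.
  have hden : historyLaw ν' alg T ⊗ₘ alg.output = (historyLaw ν alg T ⊗ₘ alg.output).withDensity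
      fun p => ENNReal.ofReal (Real.exp (∑ i, l (p.1 i))) := by
    refine Measure.ext_of_lintegral _ fun f hf => ?_
    rw [lintegral_withDensity_eq_lintegral_mul _ (by fun_prop) hf, Measure.lintegral_compProd hf,
      Measure.lintegral_compProd (Measurable.mul (by fun_prop) hf),
      historyLaw_eq_withDensity alg hl hν,
      lintegral_withDensity_eq_lintegral_mul _ (by fun_prop) hf.lintegral_kernel_prod_right']
    refine lintegral_congr fun h => ?_
    simp only [Pi.mul_apply]
    exact (lintegral_const_mul _ (hf.comp measurable_prodMk_left)).symm
  rw [← hfst] at hI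
  have hBH := exp_integral_le_measureReal_add_compl (hsum.comp measurable_fst)
    (hI.comp_measurable measurable_fst) hden (measurable_snd hS)
  have hE' : ∫ p, ((fun h : History d T => ∑ i, l (h i)) ∘ Prod.fst) p
      ∂(historyLaw ν alg T ⊗ₘ alg.output) =
      ∑ a, expectedPulls ν alg a * ∫ r, l (a, r) ∂(ν a) := by
    rw [← hE]
    conv_rhs => rw [← hfst]
    rw [integral_map measurable_fst.aemeasurable hsum.aestronglyMeasurable]
    rfl
  rw [hE'] at hBH
  simpa only [outputLaw_eq_snd, Measure.snd, Measure.real, Measure.map_apply measurable_snd hS,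
    Measure.map_apply measurable_snd hS.compl, Set.preimage_compl] using hBH

theorem exp_le_outputLaw_gaussianBandit_update (μ : Fin d → ℝ) (s : Fin d) (x : ℝ) {R : ℝ≥0}
    (hR : 0 < R) (alg : Algorithm d T) {S : Set (Fin d → ℝ)} (hS : MeasurableSet S) :
    Real.exp (-(expectedPulls (gaussianBandit μ R) alg s * (x ^ 2 / (2 * (R : ℝ) ^ 2)))) / 2 ≤
      (outputLaw (gaussianBandit μ R) alg).real S +
        (outputLaw (gaussianBandit (Function.update μ s (μ s + x)) R) alg).real Sᶜ := by
  have hv : R ^ 2 ≠ 0 := (pow_pos hR 2).ne'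
  -- The log-ratio of two normal densities on the changed arm; its mean under `μ` is `-x² / (2R²)`.
  set l : Fin d × ℝ → ℝ := fun p => if p.1 = s then
    x / ((R ^ 2 : ℝ≥0) : ℝ) * (p.2 - μ s) - x ^ 2 / (2 * ((R ^ 2 : ℝ≥0) : ℝ)) else 0 with hl
  have happ : ∀ (η : Fin d → ℝ) a, gaussianBandit η R a = gaussianReal (η a) (R ^ 2) :=
    fun _ _ => rfl
  have hid : Integrable (fun r : ℝ => r) (gaussianReal (μ s) (R ^ 2)) :=
    (memLp_id_gaussianReal' 1 (by simp)).integrable le_rfl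
  have hid' : Integrable (fun r : ℝ => r - μ s) (gaussianReal (μ s) (R ^ 2)) :=
    hid.sub (integrable_const _)
  have hlm : Measurable l := by
    refine Measurable.ite (measurable_fst (measurableSet_singleton s)) (by fun_prop) (by fun_prop)
  have hli : ∀ a, Integrable (fun r => l (a, r)) (gaussianBandit μ R a) := by
    intro a
    by_cases ha : a = s
    · subst ha
      simp only [hl, if_true, happ]
      exact (hid'.const_mul _).sub (integrable_const _)
    · simp [hl, ha]
  have hd : ∀ a, gaussianBandit (Function.update μ s (μ s + x)) R a =
      (gaussianBandit μ R a).withDensity fun r => ENNReal.ofReal (Real.exp (l (a, r))) := by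
    intro a
    by_cases ha : a = s
    · subst ha
      simp only [hl, if_true, happ, Function.update_self]
      exact gaussianReal_add_eq_withDensity _ _ hv
    · simp only [happ, Function.update_of_ne ha, hl, ha, if_false, Real.exp_zero,
        ENNReal.ofReal_one]
      exact withDensity_one.symm
  have hkl : ∑ a, expectedPulls (gaussianBandit μ R) alg a *
      ∫ r, l (a, r) ∂(gaussianBandit μ R a) =
      -(expectedPulls (gaussianBandit μ R) alg s * (x ^ 2 / (2 * (R : ℝ) ^ 2))) := by
    rw [Finset.sum_eq_single s]
    · simp only [hl, if_true, happ]
      rw [integral_sub (hid'.const_mul _) (integrable_const _),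
        integral_const_mul, integral_sub hid (integrable_const _), integral_id_gaussianReal]
      simp
    · intro a _ ha
      simp [hl, ha]
    · simp
  have h := exp_sum_le_outputLaw_add_compl alg hlm hli hd hS
  rwa [hkl] at h

end ChangeOfMeasure

/-! ### Gaps, complexity and perturbations. -/

section Gaps

variable {d T : ℕ}

theorem exists_gGap_eq {A : Finset (Fin d → ℝ)} {p : Fin d → ℝ} (hA : A.Nontrivial)
    (μ : Fin d → ℝ) (s : Fin d) : ∃ q ∈ A.erase p,
      gGap A μ p s = ENNReal.ofReal (μ ⬝ᵥ (p - q)) / ENNReal.ofReal |p s - q s| := by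
  obtain ⟨b, hb, hbp⟩ := hA.exists_ne p
  obtain ⟨q, hq, hmin⟩ := (A.erase p).exists_min_image
    (fun q => ENNReal.ofReal (μ ⬝ᵥ (p - q)) / ENNReal.ofReal |p s - q s|)
    ⟨b, Finset.mem_erase.2 ⟨hbp, hb⟩⟩
  exact ⟨q, hq, le_antisymm (iInf₂_le q hq) (le_iInf₂ hmin)⟩

theorem IsUniqueBest.dotProduct_sub_pos {A : Finset (Fin d → ℝ)} {μ p q : Fin d → ℝ}
    (h : IsUniqueBest A μ p) (hq : q ∈ A.erase p) : 0 < μ ⬝ᵥ (p - q) := by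
  rw [dotProduct_sub]
  exact sub_pos.2 (h.2 q (Finset.mem_of_mem_erase hq) (Finset.ne_of_mem_erase hq))

theorem exists_inv_gGap_toReal_ne_zero {A : Finset (Fin d → ℝ)} {μ p : Fin d → ℝ}
    (hA : A.Nontrivial) (h : IsUniqueBest A μ p) : ∃ s, (gGap A μ p s)⁻¹.toReal ≠ 0 := by
  obtain ⟨b, hb, hbp⟩ := hA.exists_ne p
  obtain ⟨s, hs⟩ := Function.ne_iff.1 hbp
  refine ⟨s, ENNReal.toReal_ne_zero.2 ⟨?_, ?_⟩⟩
  · refine ENNReal.inv_ne_zero.2 (ne_top_of_le_ne_top ?_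
      (iInf₂_le b (Finset.mem_erase.2 ⟨hbp, hb⟩)))
    refine ENNReal.div_ne_top ENNReal.ofReal_ne_top (ENNReal.ofReal_pos.2 ?_).ne'
    exact abs_pos.2 (sub_ne_zero.2 (Ne.symm hs))
  -- A zero gap would also give `toReal` the value `0`; it is excluded because the minimum is
  -- attained and `p` is the unique best action.
  · obtain ⟨q, hq, he⟩ := exists_gGap_eq (p := p) hA μ s
    rw [he]
    exact ENNReal.inv_ne_top.2 (ENNReal.div_pos (ENNReal.ofReal_pos.2
      (h.dotProduct_sub_pos hq)).ne' ENNReal.ofReal_ne_top).ne'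

/-- Some arm of finite gap is pulled at most in proportion to its share of the complexity. -/
theorem exists_expectedPulls_mul_complexity_le {A : Finset (Fin d → ℝ)} {μ p : Fin d → ℝ}
    (hA : A.Nontrivial) (h : IsUniqueBest A μ p) (ν : Kernel (Fin d) ℝ) [IsMarkovKernel ν]
    (alg : Algorithm d T) : ∃ s, (gGap A μ p s)⁻¹.toReal ≠ 0 ∧
      expectedPulls ν alg s * complexity A μ p ≤ T * (gGap A μ p s)⁻¹.toReal ^ 2 := by
  classical
  obtain ⟨s₀, hs₀⟩ := exists_inv_gGap_toReal_ne_zero hA h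
  -- Arms of infinite gap are dropped, as changing them shifts all values equally. The right side
  -- still totals `T * H`.
  have hsum : ∑ s with (gGap A μ p s)⁻¹.toReal ≠ 0, expectedPulls ν alg s * complexity A μ p ≤
      ∑ s with (gGap A μ p s)⁻¹.toReal ≠ 0, T * (gGap A μ p s)⁻¹.toReal ^ 2 := by
    have hc : ∑ s with (gGap A μ p s)⁻¹.toReal ≠ 0, (gGap A μ p s)⁻¹.toReal ^ 2 =
        complexity A μ p :=
      Finset.sum_filter_of_ne fun s _ hs h0 => hs (by simp [h0])
    rw [← Finset.mul_sum, hc, ← Finset.sum_mul, ← sum_expectedPulls ν alg]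
    refine mul_le_mul_of_nonneg_right ?_ (Finset.sum_nonneg fun _ _ => sq_nonneg _)
    exact Finset.sum_le_sum_of_subset_of_nonneg (Finset.filter_subset _ _)
      fun s _ _ => expectedPulls_nonneg ν alg s
  obtain ⟨s, hs, hle⟩ := Finset.exists_le_of_sum_le ⟨s₀, by simpa using hs₀⟩ hsum
  exact ⟨s, (Finset.mem_filter.1 hs).2, hle⟩

theorem complexity_pos {A : Finset (Fin d → ℝ)} {μ p : Fin d → ℝ}
    (hA : A.Nontrivial) (h : IsUniqueBest A μ p) : 0 < complexity A μ p := by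
  obtain ⟨s, hs⟩ := exists_inv_gGap_toReal_ne_zero hA h
  exact Finset.sum_pos' (fun _ _ => sq_nonneg _) ⟨s, Finset.mem_univ s, by positivity⟩

theorem meanReward_gaussianBandit (μ : Fin d → ℝ) (R : ℝ≥0) :
    meanReward (gaussianBandit μ R) = μ := by
  ext s
  exact integral_id_gaussianReal

/-- A perturbation of `μ` at the arm `s` which, at a size `6 / 5` of the gap of `s`, makes `p`
suboptimal; it vanishes if the gap is infinite. -/
theorem exists_perturbation {A : Finset (Fin d → ℝ)} {μ p : Fin d → ℝ} (hA : A.Nontrivial)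
    (h : IsUniqueBest A μ p) (s : Fin d) : ∃ x : ℝ,
      ENNReal.ofReal |x| ≤ 2 * gGap A μ p s ∧
      ((gGap A μ p s)⁻¹.toReal ≠ 0 →
        x ^ 2 * (gGap A μ p s)⁻¹.toReal ^ 2 ≤ 2 ∧
        ¬ IsBest A (Function.update μ s (μ s + x)) p) := by
  obtain ⟨q, hq, he⟩ := exists_gGap_eq (p := p) hA μ s
  have hg := h.dotProduct_sub_pos hq
  set g := μ ⬝ᵥ (p - q) with hgdef
  by_cases hs : p s - q s = 0
  · refine ⟨0, by simp, fun hne => absurd ?_ hne⟩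
    rw [he, hs]
    simp [ENNReal.div_zero (ENNReal.ofReal_pos.2 hg).ne']
  have habs : 0 < |p s - q s| := abs_pos.2 hs
  have he' : gGap A μ p s = ENNReal.ofReal (g / |p s - q s|) := by
    rw [he, ENNReal.ofReal_div_of_pos habs]
  have hxabs : |-(6 / 5) * (g / (p s - q s))| = 6 / 5 * (g / |p s - q s|) := by
    rw [abs_mul, abs_div, abs_of_pos hg]
    norm_num
  have hpos : 0 < g / |p s - q s| := div_pos hg habs
  -- The advantage of `p` over `q` drops from `g` to `-g / 5`. Any factor in `(1, √2]` would do: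
  -- above `1` to overturn `p`, with square at most `2` to offset the `2` in the Gaussian
  -- divergence.
  refine ⟨-(6 / 5) * (g / (p s - q s)), ?_, fun _ => ⟨?_, ?_⟩⟩
  · rw [hxabs, he', show (2 : ℝ≥0∞) = ENNReal.ofReal 2 by simp, ← ENNReal.ofReal_mul (by norm_num)]
    exact ENNReal.ofReal_le_ofReal (by linarith)
  · rw [he', ENNReal.toReal_inv, ENNReal.toReal_ofReal hpos.le, ← sq_abs, hxabs, ← mul_pow,
      mul_assoc, mul_inv_cancel₀ hpos.ne']
    norm_num
  · intro hb
    have hle := hb.2 q (Finset.mem_of_mem_erase hq)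
    rw [← sub_nonneg, ← dotProduct_sub] at hle
    have hup : Function.update μ s (μ s + -(6 / 5) * (g / (p s - q s))) =
        μ + Pi.single s (-(6 / 5) * (g / (p s - q s))) := by
      ext i
      by_cases hi : i = s
      · subst hi; simp
      · simp [hi]
    rw [hup, add_dotProduct, single_dotProduct, ← hgdef, Pi.sub_apply, mul_assoc,
      div_mul_cancel₀ _ hs] at hle
    linarith

theorem outputLaw_singleton_compl_le_errorProb {A : Finset (Fin d → ℝ)} {μ p : Fin d → ℝ}
    (h : IsUniqueBest A μ p) (R : ℝ≥0) (alg : Algorithm d T) :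
    (outputLaw (gaussianBandit μ R) alg).real {p}ᶜ ≤ errorProb A (gaussianBandit μ R) alg := by
  rw [errorProb, meanReward_gaussianBandit]
  refine measureReal_mono fun q hq hb => ?_
  exact (h.2 q hb.1 hq).not_ge (hb.2 p h.1)

theorem outputLaw_singleton_le_errorProb {A : Finset (Fin d → ℝ)} {μ p : Fin d → ℝ}
    (h : ¬ IsBest A μ p) (R : ℝ≥0) (alg : Algorithm d T) :
    (outputLaw (gaussianBandit μ R) alg).real {p} ≤ errorProb A (gaussianBandit μ R) alg := by
  rw [errorProb, meanReward_gaussianBandit]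
  refine measureReal_mono fun q hq => ?_
  rw [Set.mem_singleton_iff.1 hq]
  exact h

end Gaps

end RCPE

theorem theorem1 :
    ∃ c : ℝ, 0 < c ∧
      ∀ (d : ℕ) (A : Finset (Fin d → ℝ)) (μ pstar : Fin d → ℝ),
        A.Nontrivial → RCPE.IsUniqueBest A μ pstar →
        ∃ x : Fin d → ℝ,
          (∀ s, ENNReal.ofReal |x s| ≤ 2 * RCPE.gGap A μ pstar s) ∧
          ∀ (R : ℝ≥0), 0 < R → ∀ (T : ℕ) (alg : RCPE.Algorithm d T),
            ∃ μ' : Fin d → ℝ,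
              (μ' = μ ∨ ∃ s, μ' = Function.update μ s (μ s + x s)) ∧
              c * Real.exp (-((T : ℝ) / ((R : ℝ) ^ 2 * RCPE.complexity A μ pstar)))
                ≤ RCPE.errorProb A (RCPE.gaussianBandit μ' R) alg := by
  refine ⟨1 / 4, by norm_num, fun d A μ p hA hp => ?_⟩
  -- The perturbations are fixed before `R`, `T` and the algorithm; only the arm `s` depends on
  -- those.
  choose x hx hx' using RCPE.exists_perturbation hA hp
  refine ⟨x, hx, fun R hR T alg => ?_⟩
  obtain ⟨s, hs, hpull⟩ :=
    RCPE.exists_expectedPulls_mul_complexity_le hA hp (RCPE.gaussianBandit μ R) alg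
  obtain ⟨hxs, hbest⟩ := hx' s hs
  have hH := RCPE.complexity_pos hA hp
  have hR' : (0 : ℝ) < R := hR
  have hBH := RCPE.exp_le_outputLaw_gaussianBandit_update μ s (x s) hR alg
    (measurableSet_singleton p).compl
  rw [compl_compl] at hBH
  have hkl : RCPE.expectedPulls (RCPE.gaussianBandit μ R) alg s * (x s ^ 2 / (2 * (R : ℝ) ^ 2)) ≤
      T / ((R : ℝ) ^ 2 * RCPE.complexity A μ p) := by
    rw [← mul_div_assoc, div_le_div_iff₀ (by positivity) (by positivity)]
    have h1 := mul_le_mul_of_nonneg_right hpull (sq_nonneg (x s))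
    have h2 := mul_le_mul_of_nonneg_left hxs (Nat.cast_nonneg (α := ℝ) T)
    have h3 := mul_le_mul_of_nonneg_right (h1.trans (by linarith : _ ≤ (T : ℝ) * 2))
      (sq_nonneg (R : ℝ))
    linarith
  have hexp := Real.exp_le_exp.2 (neg_le_neg hkl)
  have h1 := RCPE.outputLaw_singleton_compl_le_errorProb hp R alg
  have h2 := RCPE.outputLaw_singleton_le_errorProb hbest R alg
  by_cases hc : 1 / 4 * Real.exp (-((T : ℝ) / ((R : ℝ) ^ 2 * RCPE.complexity A μ p))) ≤
      RCPE.errorProb A (RCPE.gaussianBandit μ R) alg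
  · exact ⟨μ, Or.inl rfl, hc⟩
  · exact ⟨_, Or.inr ⟨s, rfl⟩, by linarith⟩
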